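/- **Theorem 3.1.** Let $d$ be a squarefree positive integer, let $K=\mathbb{Q}(\sqrt d)\subset\mathbb{R}$ and let $R$ be the ring of integers of $K$. Let $u\in R$ be a unit with $u>0$, $u\neq 1$ and $N_{K/\mathbb{Q}}(u)=1$, and let $\Delta=(\Delta_n)_{n\ge 1}$ be the integer sequence $\Delta_n=N_{K/\mathbb{Q}}(u^n-1)$. A primitive prime divisor of $\Delta_n$ is a prime $p$ with $p\mid\Delta_n$ such that $p\nmid\Delta_m$ for all $1\le m<n$ with $\Delta_m\neq 0$. The Zsigmondy bound $Z(\Delta)$ is the largest $n\ge 1$ for which $\Delta_n$ has no primitive prime divisor; it is $\infty$ if there are infinitely many such $n$, and $0$ if there are none. If $u<\frac16$ or $u>6$, then $Z(\Delta)\le 6$. Otherwise one of the following holds: * $u=3+2\sqrt2$ or $u=3-2\sqrt2$, and $Z(\Delta)=2$; * $u=2+\sqrt3$ or $u=2-\sqrt3$, $Z(\Delta)=6$, and the only terms without a primitive prime divisor are $\Delta_4$ and $\Delta_6$; * $u=\frac{3+\sqrt5}{2}$ or $u=\frac{3-\sqrt5}{2}$, $Z(\Delta)=12$, and the only terms without a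 primitive prime divisor are $\Delta_6$, $\Delta_{10}$, $\Delta_{12}$ and the trivial first term $\Delta_1=-1$; * $u=\frac{5+\sqrt{21}}{2}$ or $u=\frac{5-\sqrt{21}}{2}$, $Z(\Delta)=6$, and the only term without a primitive prime divisor is $\Delta_6$. -/

import Mathlib

open scoped NumberField IntermediateField

/-- For a sequence `a 1, a 2, a 3, …` of integers (the value `a 0` is ignored), the prime `p` is a
primitive prime divisor of the term `a n`: it divides `a n`, and it divides no earlier nonzero
term. -/
def IsPrimitivePrimeDivisor (a : ℕ → ℤ) (n p : ℕ) : Prop :=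
  p.Prime ∧ (p : ℤ) ∣ a n ∧ ∀ m : ℕ, 1 ≤ m → m < n → a m ≠ 0 → ¬ (p : ℤ) ∣ a m

/-- The term `a n` has a primitive prime divisor. -/
def HasPrimitivePrimeDivisor (a : ℕ → ℤ) (n : ℕ) : Prop :=
  ∃ p : ℕ, IsPrimitivePrimeDivisor a n p

/-- The set of all indices `n ≥ 1` such that `a n` has no primitive prime divisor. -/
def nonPrimitiveIndices (a : ℕ → ℤ) : Set ℕ :=
  {n : ℕ | 1 ≤ n ∧ ¬ HasPrimitivePrimeDivisor a n}

/-- The Zsigmondy bound `Z(a)`: the largest index `n ≥ 1` such that `a n` has no primitive prime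
divisor, and `∞` if there are infinitely many such indices. (It is `0` if there are none.) -/
noncomputable def zsigmondyBound (a : ℕ → ℤ) : ℕ∞ :=
  ⨆ n ∈ nonPrimitiveIndices a, (n : ℕ∞)

/-- Sanity check: a positive value `N` of the bound is a maximum. -/
theorem zsigmondyBound_eq_of_isGreatest {a : ℕ → ℤ} {N : ℕ}
    (h : IsGreatest (nonPrimitiveIndices a) N) : zsigmondyBound a = N := by
  apply le_antisymm
  · exact iSup₂_le fun n hn => by exact_mod_cast h.2 hn
  · exact le_iSup₂ (f := fun (n : ℕ) (_ : n ∈ nonPrimitiveIndices a) => (n : ℕ∞)) N h.1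

/-- Sanity check: the bound is infinite when infinitely many terms have no primitive prime
divisor. -/
theorem zsigmondyBound_eq_top {a : ℕ → ℤ} (h : (nonPrimitiveIndices a).Infinite) :
    zsigmondyBound a = ⊤ := by
  rw [ENat.eq_top_iff_forall_gt]
  intro m
  obtain ⟨n, hn, hmn⟩ := h.exists_gt m
  exact lt_of_lt_of_le (by exact_mod_cast hmn)
    (le_iSup₂ (f := fun (n : ℕ) (_ : n ∈ nonPrimitiveIndices a) => (n : ℕ∞)) n hn)

/-- The Lehmer–Pierce sequence `Δ n = N(uⁿ - 1)` of a unit `u` of the ring of integers of `K`, as a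
sequence of integers; see `coe_lehmerPierce` for the agreement with the norm of `K/ℚ`. -/
noncomputable def lehmerPierce (K : Type*) [Field K] (u : (𝓞 K)ˣ) (n : ℕ) : ℤ :=
  Algebra.norm ℤ ((u : 𝓞 K) ^ n - 1)

theorem coe_lehmerPierce (K : Type*) [Field K] [NumberField K] (u : (𝓞 K)ˣ) (n : ℕ) :
    (lehmerPierce K u n : ℚ) = Algebra.norm ℚ (((u : 𝓞 K) : K) ^ n - 1) := by
  rw [lehmerPierce, Algebra.coe_norm_int]
  simp

/-- The field `ℚ(√d)`, as a subfield of `ℝ`. -/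
noncomputable abbrev RealQuadraticField (d : ℕ) : IntermediateField ℚ ℝ :=
  ℚ⟮(Real.sqrt (d : ℝ))⟯

instance RealQuadraticField.instNumberField (d : ℕ) : NumberField (RealQuadraticField d) where
  to_charZero := inferInstance
  to_finiteDimensional := IntermediateField.adjoin.finiteDimensional
    ⟨Polynomial.X ^ 2 - Polynomial.C (d : ℚ), Polynomial.monic_X_pow_sub_C _ two_ne_zero, by
      simp⟩

/-- A unit of the ring of integers of `ℚ(√d) ⊆ ℝ`, as a real number. -/
noncomputable def unitToReal {d : ℕ} (u : (𝓞 (RealQuadraticField d))ˣ) : ℝ :=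
  (((u : 𝓞 (RealQuadraticField d)) : RealQuadraticField d) : ℝ)

/-! Since `u` has norm 1, its conjugate is `u⁻¹`, and `t = u + u⁻¹` is an integer with `t ≥ 3`. The
sequence depends only on `t`: it is `pierce t`, and `quadNorm t (cyclotomic n ℤ)` is its cyclotomic
factor at `n`. Modulo a prime `p` the roots of `X² - tX + 1` have a common order `m`, and `p ∣ Δ_j`
exactly when `m ∣ j`. If `p` divides the cyclotomic factor at `n`, then `n = p^k m`, and `m` divides
`p - 1` or `p + 1`; for `k = 0` the prime is primitive (`exists_rank_of_prime_dvd_cyclotomic`).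
Suppose `n ≥ 7`, `n ≠ 12`, and `Δ_n` has no primitive prime divisor. Then the cyclotomic factor is,
up to sign, a power of a single prime `p ∣ n`. It is not divisible by `p³`
(`not_cube_dvd_quadNorm_cyclotomic`), yet it exceeds `p²` in absolute value
(`sq_lt_abs_quadNorm_cyclotomic`), a contradiction. The size bound fails only for `n = 10`, `t = 3`,
where the factor is exactly `5²`. At `n = 12` the factor is `(t² - 3)²`, and for `t ≥ 4` some prime
other than 2 and 3 divides it. So indices above 6 can fail only for `t = 3`. The range `1/6 ≤ u ≤ 6`
leaves `t = 3, 4, 5, 6`, settled by computing terms. -/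

section QuadNorm

open Polynomial

/-! ### Norms of integer polynomials at the roots of `X² - tX + 1` -/

/-- The monic quadratic polynomial `X² - t X + 1`. -/
noncomputable def quadPoly (t : ℤ) : ℤ[X] := X ^ 2 - C t * X + 1

theorem quadPoly_degree (t : ℤ) : (quadPoly t).degree = 2 := by
  unfold quadPoly; compute_degree!

theorem quadPoly_monic (t : ℤ) : (quadPoly t).Monic := by
  unfold quadPoly; monicity!

/-- The integer `f(α) f(β)`, where `α` and `β` are the roots of `X² - t X + 1`. -/
noncomputable def quadNorm (t : ℤ) (f : ℤ[X]) : ℤ :=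
  (f %ₘ quadPoly t).coeff 0 ^ 2 + t * (f %ₘ quadPoly t).coeff 0 * (f %ₘ quadPoly t).coeff 1 +
    (f %ₘ quadPoly t).coeff 1 ^ 2

/-- Only the remainder modulo `quadPoly t` matters at a root. Allowing any commutative ring lets one
integer be read in `ℂ` for identities, in `ℝ` for size, and in characteristic `p` for divisibility.
-/
theorem quadNorm_cast {F : Type*} [CommRing F] {t : ℤ} {α β : F} (hs : α + β = t)
    (hp : α * β = 1) (f : ℤ[X]) : (quadNorm t f : F) = aeval α f * aeval β f := by
  have hdeg : (f %ₘ quadPoly t).degree < 2 :=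
    (degree_modByMonic_lt f (quadPoly_monic t)).trans_eq (quadPoly_degree t)
  have hf := modByMonic_add_div f (quadPoly t)
  have hr : f %ₘ quadPoly t =
      C ((f %ₘ quadPoly t).coeff 1) * X + C ((f %ₘ quadPoly t).coeff 0) :=
    eq_X_add_C_of_degree_le_one (Order.le_of_lt_succ hdeg)
  have key : ∀ γ : F, γ ^ 2 - t * γ + 1 = 0 → aeval γ f =
      ((f %ₘ quadPoly t).coeff 1 : F) * γ + ((f %ₘ quadPoly t).coeff 0 : F) := by
    intro γ hγ
    have hz : aeval γ (quadPoly t) = 0 := by simpa [quadPoly] using hγ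
    have := congrArg (aeval γ) hf
    rw [map_add, map_mul, hz, zero_mul, add_zero, hr] at this
    simpa using this.symm
  rw [key α (by rw [← hs]; linear_combination -hp), key β (by rw [← hs]; linear_combination -hp)]
  unfold quadNorm
  push_cast
  rw [← hs]
  linear_combination (-((f %ₘ quadPoly t).coeff 1 : F) ^ 2) * hp

theorem exists_quadratic_roots (t : ℤ) (F : Type*) [Field F] [IsAlgClosed F] :
    ∃ α β : F, α + β = t ∧ α * β = 1 := by
  obtain ⟨α, hα⟩ := IsAlgClosed.exists_root (X ^ 2 - C (t : F) * X + 1 : F[X]) (by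
    have : (X ^ 2 - C (t : F) * X + 1 : F[X]).degree = 2 := by compute_degree!
    rw [this]; decide)
  refine ⟨α, t - α, by ring, ?_⟩
  have h : α ^ 2 - t * α + 1 = 0 := by simpa [IsRoot] using hα
  linear_combination -h

theorem quadNorm_mul (t : ℤ) (f g : ℤ[X]) :
    quadNorm t (f * g) = quadNorm t f * quadNorm t g := by
  obtain ⟨α, β, hs, hp⟩ := exists_quadratic_roots t ℂ
  have : ((quadNorm t (f * g) : ℤ) : ℂ) = (quadNorm t f * quadNorm t g : ℤ) := by
    push_cast
    simp only [quadNorm_cast hs hp, map_mul]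
    ring
  exact_mod_cast this

theorem quadNorm_dvd {t : ℤ} {f g : ℤ[X]} (h : f ∣ g) : quadNorm t f ∣ quadNorm t g := by
  obtain ⟨k, rfl⟩ := h
  exact ⟨_, quadNorm_mul t f k⟩

/-! ### The sequence as a function of the trace -/

/-- The sequence `(αⁿ - 1)(βⁿ - 1)`, where `α` and `β` are the roots of `X² - t X + 1`. -/
noncomputable def pierce (t : ℤ) (n : ℕ) : ℤ := quadNorm t (X ^ n - 1)

theorem pierce_cast {F : Type*} [CommRing F] {t : ℤ} {α β : F} (hs : α + β = t)
    (hp : α * β = 1) (n : ℕ) : (pierce t n : F) = (α ^ n - 1) * (β ^ n - 1) := by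
  simp [pierce, quadNorm_cast hs hp]

theorem add_pow_eq_two_sub_pierce {F : Type*} [CommRing F] {t : ℤ} {α β : F} (hs : α + β = t)
    (hp : α * β = 1) (n : ℕ) : α ^ n + β ^ n = ((2 - pierce t n : ℤ) : F) := by
  have : α ^ n * β ^ n = 1 := by rw [← mul_pow, hp, one_pow]
  push_cast
  rw [pierce_cast hs hp]
  linear_combination this

/-- Substituting `X ^ N` replaces the roots by their `N`-th powers, whose trace is `2 - pierce t N`.
Hence this expression recurs below as the new trace. -/
theorem quadNorm_expand (t : ℤ) (N : ℕ) (f : ℤ[X]) :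
    quadNorm t (expand ℤ N f) = quadNorm (2 - pierce t N) f := by
  obtain ⟨α, β, hs, hp⟩ := exists_quadratic_roots t ℂ
  have : ((quadNorm t (expand ℤ N f) : ℤ) : ℂ) = (quadNorm (2 - pierce t N) f : ℤ) := by
    rw [quadNorm_cast hs hp, quadNorm_cast (add_pow_eq_two_sub_pierce hs hp N)
      (pow_mul_pow_eq_one N hp), expand_aeval, expand_aeval]
  exact_mod_cast this

theorem pierce_mul (t : ℤ) (N n : ℕ) : pierce t (N * n) = pierce (2 - pierce t N) n := by
  rw [pierce, pierce, ← quadNorm_expand]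
  simp [pow_mul]

theorem pierce_zero (t : ℤ) : pierce t 0 = 0 := by simp [pierce, quadNorm]

theorem pierce_one (t : ℤ) : pierce t 1 = 2 - t := by
  obtain ⟨α, β, hs, hp⟩ := exists_quadratic_roots t ℂ
  have := add_pow_eq_two_sub_pierce hs hp 1
  rw [pow_one, pow_one, hs] at this
  have : t = 2 - pierce t 1 := by exact_mod_cast this
  linarith

theorem pierce_add_two (t : ℤ) (n : ℕ) :
    pierce t (n + 2) = t * pierce t (n + 1) - pierce t n + 2 * (2 - t) := by
  obtain ⟨α, β, hs, hp⟩ := exists_quadratic_roots t ℂ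
  have h : (pierce t (n + 2) : ℂ) = (t * pierce t (n + 1) - pierce t n + 2 * (2 - t) : ℤ) := by
    push_cast
    rw [pierce_cast hs hp, pierce_cast hs hp, pierce_cast hs hp, ← hs]
    have h := pow_mul_pow_eq_one n hp
    have e1 : α ^ (n + 2) = α * α ^ (n + 1) := by ring
    have e2 : β ^ (n + 2) = β * β ^ (n + 1) := by ring
    have e3 : β * α ^ (n + 1) = α ^ n := by linear_combination α ^ n * hp
    have e4 : α * β ^ (n + 1) = β ^ n := by linear_combination β ^ n * hp
    have h1 := pow_mul_pow_eq_one (n + 1) hp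
    have h2 := pow_mul_pow_eq_one (n + 2) hp
    linear_combination h2 - e1 - e2 + h - (α + β) * h1 + e3 + e4
  exact_mod_cast h

theorem pierce_two (t : ℤ) : pierce t 2 = 4 - t ^ 2 := by
  rw [pierce_add_two, zero_add, pierce_one, pierce_zero]; ring

theorem pierce_three (t : ℤ) : pierce t 3 = (2 - t) * (t + 1) ^ 2 := by
  rw [pierce_add_two, pierce_two, pierce_one]; ring

theorem exists_real_roots {t : ℤ} (ht : 3 ≤ t) :
    ∃ x y : ℝ, 1 < x ∧ 0 < y ∧ y < 1 ∧ x + y = t ∧ x * y = 1 := by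
  have ht' : (3 : ℝ) ≤ t := by exact_mod_cast ht
  have hpos : (0 : ℝ) < t ^ 2 - 4 := by nlinarith
  have hsq := Real.sq_sqrt hpos.le
  have hs := Real.sqrt_pos.2 hpos
  have hlt : √((t : ℝ) ^ 2 - 4) < t := by nlinarith
  have h1 : 1 < (t + √((t : ℝ) ^ 2 - 4)) / 2 := by linarith
  have hxy : (t + √((t : ℝ) ^ 2 - 4)) / 2 * ((t - √((t : ℝ) ^ 2 - 4)) / 2) = 1 := by
    linear_combination -hsq / 4
  have h2 : 0 < (t - √((t : ℝ) ^ 2 - 4)) / 2 := by linarith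
  refine ⟨_, _, h1, h2, ?_, by ring, hxy⟩
  nlinarith

theorem three_le_two_sub_pierce {t : ℤ} (ht : 3 ≤ t) {n : ℕ} (hn : n ≠ 0) :
    3 ≤ 2 - pierce t n := by
  obtain ⟨x, y, hx, hy, hy1, hs, hp⟩ := exists_real_roots ht
  have h : (pierce t n : ℝ) < 0 := by
    rw [pierce_cast hs hp]
    exact mul_neg_of_pos_of_neg (sub_pos.2 (one_lt_pow₀ hx hn))
      (sub_neg.2 (pow_lt_one₀ hy.le hy1 hn))
  have : pierce t n < 0 := by exact_mod_cast h
  omega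

theorem pierce_ne_zero {t : ℤ} (ht : 3 ≤ t) {n : ℕ} (hn : n ≠ 0) : pierce t n ≠ 0 := by
  have := three_le_two_sub_pierce ht hn
  omega

/-! ### Quotients of terms at odd multiples -/

/-- The quotients `(v^(2h+1) - 1) / (v^h (v - 1))` as polynomials in `T = v + v⁻¹`. -/
def oddQuotient (T : ℤ) : ℕ → ℤ
  | 0 => 1
  | 1 => T + 1
  | h + 2 => T * oddQuotient T (h + 1) - oddQuotient T h

theorem oddQuotient_mul {F : Type*} [CommRing F] {T : ℤ} {v w : F} (hs : v + w = T)
    (hp : v * w = 1) : ∀ h : ℕ,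
    (oddQuotient T h : F) * v ^ h * (v - 1) = v ^ (2 * h + 1) - 1
  | 0 => by simp [oddQuotient]
  | 1 => by
    simp only [oddQuotient]
    push_cast
    rw [← hs]
    linear_combination (v - 1) * hp
  | h + 2 => by
    have h0 := oddQuotient_mul hs hp h
    have h1 := oddQuotient_mul hs hp (h + 1)
    simp only [oddQuotient]
    push_cast
    rw [← hs]
    linear_combination (v ^ 2 + 1) * h1 - v ^ 2 * h0 +
      (oddQuotient T (h + 1) : F) * v ^ (h + 1) * (v - 1) * hp

theorem pierce_odd (T : ℤ) (h : ℕ) :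
    pierce T (2 * h + 1) = (2 - T) * oddQuotient T h ^ 2 := by
  obtain ⟨α, β, hs, hp⟩ := exists_quadratic_roots T ℂ
  have h : (pierce T (2 * h + 1) : ℂ) = ((2 - T) * oddQuotient T h ^ 2 : ℤ) := by
    have h1 := pierce_cast hs hp 1
    rw [pierce_one] at h1
    push_cast at h1 ⊢
    rw [pierce_cast hs hp, h1, ← oddQuotient_mul hs hp h,
      ← oddQuotient_mul (add_comm α β ▸ hs) (mul_comm α β ▸ hp) h]
    linear_combination (oddQuotient T h : ℂ) ^ 2 * (α - 1) * (β - 1) * pow_mul_pow_eq_one h hp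
  exact_mod_cast h

/-- First-order Taylor expansion at `T = 2`, that is at `v = 1`; the factor 6 clears the denominator
of the linear coefficient. -/
theorem exists_oddQuotient_expansion (T : ℤ) : ∀ h : ℕ, ∃ e : ℤ,
    6 * oddQuotient T h = (2 * h + 1) * (6 + (T - 2) * (h * (h + 1))) + (T - 2) ^ 2 * e
  | 0 => ⟨0, by simp [oddQuotient]⟩
  | 1 => ⟨0, by simp only [oddQuotient]; push_cast; ring⟩
  | h + 2 => by
    obtain ⟨e0, h0⟩ := exists_oddQuotient_expansion T h
    obtain ⟨e1, h1⟩ := exists_oddQuotient_expansion T (h + 1)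
    refine ⟨T * e1 - e0 + (2 * h + 3) * ((h + 1) * (h + 2)), ?_⟩
    simp only [oddQuotient]
    push_cast at h1 ⊢
    linear_combination T * h1 - h0

theorem le_oddQuotient {T : ℤ} (hT : 3 ≤ T) : ∀ h : ℕ,
    0 < oddQuotient T h ∧ 2 * oddQuotient T h ≤ oddQuotient T (h + 1)
  | 0 => by simp only [oddQuotient]; omega
  | h + 1 => by
    obtain ⟨h0, h1⟩ := le_oddQuotient hT h
    refine ⟨by linarith, ?_⟩
    simp only [oddQuotient]
    nlinarith

/-! ### Prime divisors of the cyclotomic factor and their multiplicity -/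

/-- In characteristic `p` the roots of the cyclotomic polynomial of index `p ^ k * m` are the
primitive `m`-th roots of unity, so `m` is the order of `α`. -/
theorem exists_rank_of_prime_dvd_cyclotomic {t : ℤ} {n p : ℕ} (hn : n ≠ 0) (hp : p.Prime)
    (h : (p : ℤ) ∣ quadNorm t (cyclotomic n ℤ)) :
    ∃ k m, n = p ^ k * m ∧ ¬ p ∣ m ∧ (∀ j, (p : ℤ) ∣ pierce t j ↔ m ∣ j) ∧
      (m ∣ p - 1 ∨ m ∣ p + 1) := by
  have := Fact.mk hp
  let F := AlgebraicClosure (ZMod p)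
  have : CharP F p := charP_of_injective_algebraMap (algebraMap (ZMod p) F).injective p
  obtain ⟨α, β, hs, hαβ⟩ := exists_quadratic_roots t F
  obtain ⟨k, m, hpm, hnm⟩ := Nat.exists_eq_pow_mul_and_not_dvd hn p hp.ne_one
  have hα0 : α ≠ 0 := left_ne_zero_of_mul_eq_one hαβ
  have hβ : β = α⁻¹ := eq_inv_of_mul_eq_one_right hαβ
  have : NeZero (m : F) := ⟨fun h0 => hpm ((CharP.cast_eq_zero_iff F p m).1 h0)⟩
  have hroot : (cyclotomic n F).IsRoot α ∨ (cyclotomic n F).IsRoot β := by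
    have h0 := (CharP.intCast_eq_zero_iff F p _).2 h
    rw [quadNorm_cast hs hαβ] at h0
    simpa [aeval_def, eval₂_eq_eval_map, IsRoot] using h0
  have hprim : IsPrimitiveRoot α m := by
    rw [hnm, isRoot_cyclotomic_prime_pow_mul_iff_of_charP,
      isRoot_cyclotomic_prime_pow_mul_iff_of_charP, hβ, IsPrimitiveRoot.inv_iff, or_self] at hroot
    exact hroot
  have hpj : ∀ j, (p : ℤ) ∣ pierce t j ↔ m ∣ j := by
    intro j
    rw [← CharP.intCast_eq_zero_iff F p, pierce_cast hs hαβ, hβ, ← hprim.pow_eq_one_iff_dvd,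
      mul_eq_zero, sub_eq_zero, sub_eq_zero, inv_pow, inv_eq_one, or_self]
  refine ⟨k, m, hnm, hpm, hpj, ?_⟩
  have ht : (t : F) ^ p = t := by
    have := map_intCast (frobenius F p) t
    rwa [frobenius_def] at this
  have hfr : α ^ p + β ^ p = t := by rw [← add_pow_char, hs, ht]
  have hmul := pow_mul_pow_eq_one p hαβ
  -- Frobenius fixes `t`, so `α ^ p` is again a root of `X² - tX + 1`: it is `α` or `α⁻¹`.
  have : (α ^ p - α) * (α ^ p - β) = 0 := by
    linear_combination α ^ p * hfr - hmul - α ^ p * hs + hαβ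
  rw [← hprim.pow_eq_one_iff_dvd, ← hprim.pow_eq_one_iff_dvd]
  rcases mul_eq_zero.1 this with h1 | h1
  · left
    apply mul_right_cancel₀ hα0
    rw [one_mul, pow_sub_one_mul hp.ne_zero]
    exact sub_eq_zero.1 h1
  · right
    rw [pow_succ, sub_eq_zero.1 h1, mul_comm, hαβ]

theorem quadNorm_cyclotomic_dvd_of_pierce_eq {t : ℤ} (ht : 3 ≤ t) {N n : ℕ}
    (hN : N ∈ n.properDivisors) {q : ℤ} (h : pierce t n = pierce t N * q) :
    quadNorm t (cyclotomic n ℤ) ∣ q := by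
  have hd := quadNorm_dvd (t := t) (X_pow_sub_one_mul_cyclotomic_dvd_X_pow_sub_one_of_dvd ℤ hN)
  rw [quadNorm_mul] at hd
  have hN0 : N ≠ 0 := by
    rintro rfl
    have := Nat.mem_properDivisors.1 hN
    have := zero_dvd_iff.1 this.1
    omega
  have hd : pierce t N * quadNorm t (cyclotomic n ℤ) ∣ pierce t N * q := h ▸ hd
  exact (mul_dvd_mul_iff_left (pierce_ne_zero ht hN0)).1 hd

theorem Int.prime_sq_dvd_of_cube_dvd_sq {p : ℕ} (hp : p.Prime) {D : ℤ}
    (h : (p : ℤ) ^ 3 ∣ D ^ 2) : (p : ℤ) ^ 2 ∣ D := by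
  have hp' := Nat.prime_iff_prime_int.1 hp
  obtain ⟨E, rfl⟩ := hp'.dvd_of_dvd_pow ((dvd_pow_self _ three_ne_zero).trans h)
  rw [mul_pow, pow_succ, mul_dvd_mul_iff_left (pow_ne_zero _ hp'.ne_zero)] at h
  rw [sq]
  exact mul_dvd_mul_left _ (hp'.dvd_of_dvd_pow h)

/-- By the expansion, six times the quotient is `6p` modulo `p²`, so `p²` could divide it only if `p
∣ 6`. -/
theorem not_sq_dvd_oddQuotient {p h : ℕ} (hp : p.Prime) (hp5 : 5 ≤ p) (hh : p = 2 * h + 1) {T : ℤ}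
    (hT : (p : ℤ) ∣ T - 2) : ¬ (p : ℤ) ^ 2 ∣ oddQuotient T h := by
  rintro ⟨D, hD⟩
  obtain ⟨e, he⟩ := exists_oddQuotient_expansion T h
  obtain ⟨r, hr⟩ := hT
  have hp0 : (p : ℤ) ≠ 0 := by exact_mod_cast hp.ne_zero
  have hph : (2 * h + 1 : ℤ) = p := by exact_mod_cast hh.symm
  rw [hD, hr, hph] at he
  have h6 : (p : ℤ) ∣ 6 := by
    refine ⟨6 * D - r * (h * (h + 1)) - r ^ 2 * e, mul_left_cancel₀ hp0 ?_⟩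
    linear_combination -he
  have h6' : p ∣ 6 := by exact_mod_cast h6
  have := Nat.le_of_dvd (by norm_num) h6'
  interval_cases p
  · omega
  · omega

theorem eight_dvd_of_rank_two {k m n : ℕ} (hn : n = 2 ^ k * m) (hm : m ∣ 2 - 1 ∨ m ∣ 2 + 1)
    (hn7 : 7 ≤ n) (hn12 : n ≠ 12) : 3 ≤ k := by
  have hm3 : m = 1 ∨ m = 3 := by
    rcases hm with h | h
    · exact .inl (Nat.dvd_one.1 h)
    · exact (Nat.dvd_prime Nat.prime_three).1 h
  by_contra! hk
  interval_cases k <;> rcases hm3 with rfl | rfl <;> omega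

theorem nine_dvd_of_rank_three {k m n : ℕ} (hn : n = 3 ^ k * m) (hm : m ∣ 3 - 1 ∨ m ∣ 3 + 1)
    (hn7 : 7 ≤ n) (hn12 : n ≠ 12) : 2 ≤ k := by
  have hm4 : m ∣ 4 := by
    rcases hm with h | h
    · exact h.trans (by norm_num)
    · exact h
  have := Nat.le_of_dvd (by norm_num) hm4
  by_contra! hk
  interval_cases k <;> interval_cases m <;> omega

/-- The cyclotomic factor divides `Δ_n / Δ_{n/p}`, which is a perfect square `D²` in each case, and
`p² ∤ D`. For `p = 2, 3` this needs `8 ∣ n`, `9 ∣ n`, so that `D` is expressed through the trace at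
`n/8`, `n/9`. -/
theorem not_cube_dvd_quadNorm_cyclotomic {t : ℤ} (ht : 3 ≤ t) {n p k m : ℕ} (hp : p.Prime)
    (hn : n = p ^ k * m) (hk : k ≠ 0) (hj : ∀ j, (p : ℤ) ∣ pierce t j ↔ m ∣ j)
    (hm : m ∣ p - 1 ∨ m ∣ p + 1) (hn7 : 7 ≤ n) (hn12 : n ≠ 12) :
    ¬ (p : ℤ) ^ 3 ∣ quadNorm t (cyclotomic n ℤ) := by
  intro hdvd
  have hp2 := hp.two_le
  rcases hp.eq_two_or_odd' with rfl | ⟨h, hh⟩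
  · have hk3 := eight_dvd_of_rank_two hn hm hn7 hn12
    obtain ⟨l, rfl⟩ := Nat.exists_eq_add_of_le' hk3
    obtain ⟨r, hr⟩ := (hj (2 ^ l * m)).2 (dvd_mul_left _ _)
    have hn8 : n = (2 ^ l * m) * 8 := by rw [hn]; ring
    have h4 : ∀ T, pierce T 4 = pierce (2 - pierce T 2) 2 := fun T => pierce_mul T 2 2
    have h8 : ∀ T, pierce T 8 = pierce (2 - pierce T 4) 2 := fun T => pierce_mul T 4 2
    have := quadNorm_cyclotomic_dvd_of_pierce_eq ht (n := n) (N := (2 ^ l * m) * 4)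
      (q := ((2 - pierce t (2 ^ l * m)) ^ 2 - 2) ^ 2)
      (Nat.mem_properDivisors.2 ⟨⟨2, by rw [hn8]; ring⟩, by omega⟩)
      (by rw [hn8, pierce_mul, pierce_mul t _ 4, h8, h4, pierce_two, pierce_two, pierce_two]; ring)
    have h3 := hdvd.trans this
    rw [hr] at h3
    obtain ⟨s, hs⟩ := h3
    push_cast at hs
    -- `2 - 2r` is even, so its square minus 2 is twice an odd number, and the square of that is 4
    -- modulo 8.
    ring_nf at hs
    omega
  · rcases (by omega : p = 3 ∨ 5 ≤ p) with rfl | hp5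
    · have hk2 := nine_dvd_of_rank_three hn hm hn7 hn12
      obtain ⟨l, rfl⟩ := Nat.exists_eq_add_of_le' hk2
      obtain ⟨r, hr⟩ := (hj (3 ^ l * m)).2 (dvd_mul_left _ _)
      have hn9 : n = (3 ^ l * m) * 9 := by rw [hn]; ring
      have h9 : ∀ T, pierce T 9 = pierce (2 - pierce T 3) 3 := fun T => pierce_mul T 3 3
      have := quadNorm_cyclotomic_dvd_of_pierce_eq ht (n := n) (N := (3 ^ l * m) * 3)
        (q := (3 - pierce (2 - pierce t (3 ^ l * m)) 3) ^ 2)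
        (Nat.mem_properDivisors.2 ⟨⟨3, by rw [hn9]; ring⟩, by omega⟩)
        (by rw [hn9, pierce_mul, pierce_mul t _ 3, h9, pierce_three (2 - pierce _ 3)]; ring)
      have h3 := Int.prime_sq_dvd_of_cube_dvd_sq hp (hdvd.trans this)
      rw [pierce_three, hr] at h3
      obtain ⟨s, hs⟩ := h3
      push_cast at hs
      -- The base is `3 - 3r(3 - 3r)²`, which is 3 modulo 9.
      ring_nf at hs
      omega
    · obtain ⟨l, rfl⟩ := Nat.exists_eq_add_of_le' (Nat.one_le_iff_ne_zero.2 hk)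
      have hnp : n = (p ^ l * m) * p := by rw [hn]; ring
      have hT := (hj (p ^ l * m)).2 (dvd_mul_left _ _)
      have := quadNorm_cyclotomic_dvd_of_pierce_eq ht (n := n) (N := p ^ l * m)
        (q := oddQuotient (2 - pierce t (p ^ l * m)) h ^ 2)
        (Nat.mem_properDivisors.2 ⟨⟨p, hnp⟩, by nlinarith⟩)
        (by rw [hnp, pierce_mul, hh, pierce_odd]; ring)
      refine not_sq_dvd_oddQuotient hp hp5 hh ?_
        (Int.prime_sq_dvd_of_cube_dvd_sq hp (hdvd.trans this))
      rw [show 2 - pierce t (p ^ l * m) - 2 = -pierce t (p ^ l * m) by ring]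
      exact hT.neg_right

/-! ### Size of the cyclotomic factor -/

theorem abs_aeval_cyclotomic_bounds (m : ℕ) {x : ℝ} (hx : 0 ≤ x) :
    |x - 1| ^ m.totient ≤ |aeval x (cyclotomic m ℤ)| ∧
      |aeval x (cyclotomic m ℤ)| ≤ (x + 1) ^ m.totient := by
  rcases m.eq_zero_or_pos with rfl | hm
  · simp
  have hζ := Complex.isPrimitiveRoot_exp m hm.ne'
  have hnorm : |aeval x (cyclotomic m ℤ)| = ∏ ζ ∈ primitiveRoots m ℂ, ‖(x : ℂ) - ζ‖ := by
    have h1 : ((aeval x (cyclotomic m ℤ) : ℝ) : ℂ) = (cyclotomic m ℂ).eval (x : ℂ) := by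
      rw [← map_cyclotomic_int m ℂ, eval_map_intCast_ofReal]
    rw [← Real.norm_eq_abs, ← Complex.norm_real, h1, cyclotomic_eq_prod_X_sub_primitiveRoots hζ,
      eval_prod, norm_prod]
    simp
  have hone : ∀ ζ ∈ primitiveRoots m ℂ, ‖ζ‖ = 1 := fun ζ h =>
    ((mem_primitiveRoots hm).1 h).norm'_eq_one hm.ne'
  rw [hnorm, ← Complex.card_primitiveRoots m, ← Finset.prod_const, ← Finset.prod_const]
  refine ⟨Finset.prod_le_prod (fun _ _ => abs_nonneg _) fun ζ h => ?_,
    Finset.prod_le_prod (fun _ _ => norm_nonneg _) fun ζ h => ?_⟩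
  · have := abs_norm_sub_norm_le (x : ℂ) ζ
    rwa [hone ζ h, Complex.norm_real, Real.norm_of_nonneg hx] at this
  · have := norm_sub_le (x : ℂ) ζ
    rwa [hone ζ h, Complex.norm_real, Real.norm_of_nonneg hx] at this
where
  eval_map_intCast_ofReal {f : ℤ[X]} {x : ℝ} :
      ((aeval x f : ℝ) : ℂ) = (f.map (Int.castRingHom ℂ)).eval (x : ℂ) := by
    have := aeval_algebraMap_apply (A := ℝ) ℂ x f
    rw [Complex.coe_algebraMap] at this
    rw [← this, eval_map, aeval_def]
    rfl

theorem abs_quadNorm_cyclotomic_bounds {s : ℤ} (hs : 3 ≤ s) (m : ℕ) :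
    (s - 2) ^ m.totient ≤ |quadNorm s (cyclotomic m ℤ)| ∧
      |quadNorm s (cyclotomic m ℤ)| ≤ (s + 2) ^ m.totient := by
  obtain ⟨x, y, hx, hy, hy1, hxy, hp⟩ := exists_real_roots hs
  obtain ⟨h1, h2⟩ := abs_aeval_cyclotomic_bounds m (zero_le_one.trans hx.le)
  obtain ⟨h3, h4⟩ := abs_aeval_cyclotomic_bounds m hy.le
  have hlow : (s - 2 : ℝ) = |x - 1| * |y - 1| := by
    rw [abs_of_pos (by linarith), abs_of_neg (by linarith)]
    linear_combination -hxy + hp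
  have hup : (s + 2 : ℝ) = (x + 1) * (y + 1) := by linear_combination -hxy - hp
  have hc : ((|quadNorm s (cyclotomic m ℤ)| : ℤ) : ℝ) =
      |aeval x (cyclotomic m ℤ)| * |aeval y (cyclotomic m ℤ)| := by
    rw [Int.cast_abs, quadNorm_cast hxy hp, abs_mul]
  constructor
  · have : ((s - 2 : ℤ) : ℝ) ^ m.totient ≤ (|quadNorm s (cyclotomic m ℤ)| : ℤ) := by
      rw [hc]
      push_cast
      rw [hlow, mul_pow]
      gcongr
    exact_mod_cast this
  · have : ((|quadNorm s (cyclotomic m ℤ)| : ℤ) : ℝ) ≤ ((s + 2 : ℤ) : ℝ) ^ m.totient := by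
      rw [hc]
      push_cast
      rw [hup, mul_pow]
      gcongr
    exact_mod_cast this

theorem cyclotomic_prime_pow_succ_mul {p : ℕ} (hp : p.Prime) (m l : ℕ) :
    cyclotomic (p ^ (l + 1) * m) ℤ = expand ℤ (p ^ l) (cyclotomic (m * p) ℤ) := by
  induction l with
  | zero => simp [mul_comm]
  | succ l ih =>
    rw [pow_succ' p l, expand_mul, ← ih, cyclotomic_expand_eq_cyclotomic hp
      ((dvd_pow_self p l.succ_ne_zero).mul_right m)]
    congr 1
    simp only [Nat.succ_eq_add_one]
    ring

/-- Let `s` be the trace at `p ^ l`. From `Φ_m(X^p) = Φ_{mp}(X) Φ_m(X)`, the factor is a quotient of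
norms of `Φ_m` at the traces `2 - pierce s p` and `s`; bound the former below and the latter above.
-/
theorem lt_abs_quadNorm_cyclotomic_of_pow_lt {t : ℤ} (ht : 3 ≤ t) {p m l : ℕ} (hp : p.Prime)
    (hpm : ¬ p ∣ m) {B : ℤ}
    (hB : B * (2 - pierce t (p ^ l) + 2) ^ m.totient <
      (-pierce (2 - pierce t (p ^ l)) p) ^ m.totient) :
    B < |quadNorm t (cyclotomic (p ^ (l + 1) * m) ℤ)| := by
  have hs := three_le_two_sub_pierce ht (pow_ne_zero l hp.ne_zero)
  rw [cyclotomic_prime_pow_succ_mul hp, quadNorm_expand]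
  set s := 2 - pierce t (p ^ l)
  have h := quadNorm_expand s p (cyclotomic m ℤ)
  rw [cyclotomic_expand_eq_cyclotomic_mul hp hpm, quadNorm_mul] at h
  have h1 := (abs_quadNorm_cyclotomic_bounds (three_le_two_sub_pierce hs hp.ne_zero) m).1
  have h2 := (abs_quadNorm_cyclotomic_bounds hs m).2
  rw [← h, abs_mul, show 2 - pierce s p - 2 = -pierce s p by ring] at h1
  by_contra! hle
  have h3 : 0 < (s + 2) ^ m.totient := pow_pos (by linarith) _
  have h4 := mul_le_mul hle h2 (abs_nonneg _) ((abs_nonneg _).trans hle)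
  linarith

theorem lt_abs_quadNorm_cyclotomic {t : ℤ} (ht : 3 ≤ t) {p m l : ℕ} (hp : p.Prime)
    (hpm : ¬ p ∣ m) {B : ℤ} (hB1 : 1 ≤ B)
    (hB : B * (2 - pierce t (p ^ l) + 2) < -pierce (2 - pierce t (p ^ l)) p) :
    B < |quadNorm t (cyclotomic (p ^ (l + 1) * m) ℤ)| := by
  have hs := three_le_two_sub_pierce ht (pow_ne_zero l hp.ne_zero)
  have hm : m ≠ 0 := by rintro rfl; exact hpm (dvd_zero p)
  have hφ : m.totient ≠ 0 := (Nat.totient_pos.2 (Nat.pos_of_ne_zero hm)).ne'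
  refine lt_abs_quadNorm_cyclotomic_of_pow_lt ht hp hpm ?_
  calc B * (2 - pierce t (p ^ l) + 2) ^ m.totient
      ≤ B ^ m.totient * (2 - pierce t (p ^ l) + 2) ^ m.totient :=
        mul_le_mul_of_nonneg_right (le_self_pow₀ hB1 hφ) (pow_nonneg (by linarith) _)
    _ = (B * (2 - pierce t (p ^ l) + 2)) ^ m.totient := (mul_pow _ _ _).symm
    _ < _ := pow_lt_pow_left₀ hB (mul_nonneg (by linarith) (by linarith)) hφ

theorem four_le_oddQuotient {s : ℤ} (hs : 3 ≤ s) (h : ℕ) : 4 ≤ oddQuotient s (h + 1) := by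
  induction h with
  | zero => simp only [oddQuotient]; linarith
  | succ h ih => linarith [(le_oddQuotient hs (h + 1)).2]

/-- With `p = 2h + 7` prime this gives `4p`, enough for the size bound; it fails for `p = 5`, `s =
3`, where the quotient is 11. -/
theorem lt_oddQuotient {s : ℤ} (hs : 3 ≤ s) (h : ℕ) :
    4 * (2 * (h + 3 : ℕ) + 1 : ℤ) ≤ oddQuotient s (h + 3) := by
  induction h with
  | zero =>
    simp only [oddQuotient]
    push_cast
    nlinarith [mul_nonneg (sub_nonneg.2 hs) (sub_nonneg.2 hs),
      mul_nonneg (sub_nonneg.2 hs) (mul_nonneg (sub_nonneg.2 hs) (sub_nonneg.2 hs))]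
  | succ h ih =>
    have := (le_oddQuotient hs (h + 3)).2
    rw [show h + 1 + 3 = h + 3 + 1 from rfl]
    push_cast at ih ⊢
    linarith

theorem eighteen_le_two_sub_pierce {t : ℤ} (ht : 3 ≤ t) {N h : ℕ} (hN : N ≠ 0) :
    18 ≤ 2 - pierce t (N * (2 * (h + 1) + 1)) := by
  have hs := three_le_two_sub_pierce ht hN
  rw [pierce_mul, pierce_odd]
  nlinarith [four_le_oddQuotient hs h]

theorem fortySeven_le_two_sub_pierce {t : ℤ} (ht : 3 ≤ t) {N : ℕ} (hN : N ≠ 0) :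
    47 ≤ 2 - pierce t (N * 4) := by
  have hs := three_le_two_sub_pierce ht hN
  rw [pierce_mul, show ∀ T, pierce T 4 = pierce (2 - pierce T 2) 2 from fun T => pierce_mul T 2 2,
    pierce_two, pierce_two]
  nlinarith [mul_self_nonneg (2 - pierce t N - 3),
    mul_self_le_mul_self (by norm_num : (0 : ℤ) ≤ 3) hs]

theorem sq_lt_abs_quadNorm_cyclotomic {t : ℤ} (ht : 3 ≤ t) {n p k m : ℕ} (hp : p.Prime)
    (hn : n = p ^ k * m) (hk : k ≠ 0) (hpm : ¬ p ∣ m) (hm : m ∣ p - 1 ∨ m ∣ p + 1)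
    (hn7 : 7 ≤ n) (hn12 : n ≠ 12) (hn10 : n = 10 → t ≠ 3) :
    (p : ℤ) ^ 2 < |quadNorm t (cyclotomic n ℤ)| := by
  obtain ⟨l, rfl⟩ := Nat.exists_eq_add_of_le' (Nat.one_le_iff_ne_zero.2 hk)
  have hs := three_le_two_sub_pierce ht (pow_ne_zero l hp.ne_zero)
  have hp1 : 1 ≤ (p : ℤ) ^ 2 := one_le_pow₀ (by exact_mod_cast hp.one_le)
  have hp2 := hp.two_le
  subst hn
  rcases hp.eq_two_or_odd' with rfl | ⟨h, hh⟩
  · refine lt_abs_quadNorm_cyclotomic ht hp hpm hp1 ?_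
    have := eight_dvd_of_rank_two rfl hm hn7 hn12
    obtain ⟨j, rfl⟩ := Nat.exists_eq_add_of_le' (by omega : 2 ≤ l)
    have := fortySeven_le_two_sub_pierce ht (N := 2 ^ j) (by positivity)
    rw [pierce_two, show 2 ^ (j + 2) = 2 ^ j * 4 by ring]
    push_cast
    nlinarith
  rcases (by omega : p = 3 ∨ p = 5 ∨ 6 ≤ p) with rfl | rfl | hp6
  · refine lt_abs_quadNorm_cyclotomic ht hp hpm hp1 ?_
    have := nine_dvd_of_rank_three rfl hm hn7 hn12
    obtain ⟨j, rfl⟩ := Nat.exists_eq_add_of_le' (by omega : 1 ≤ l)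
    have := eighteen_le_two_sub_pierce ht (N := 3 ^ j) (h := 0) (by positivity)
    rw [pierce_three, show 3 ^ (j + 1) = 3 ^ j * (2 * (0 + 1) + 1) by ring]
    set s := 2 - pierce t (3 ^ j * (2 * (0 + 1) + 1))
    push_cast
    nlinarith [mul_self_le_mul_self (by norm_num : (0 : ℤ) ≤ 19) (by linarith : 19 ≤ s + 1)]
  · have h5 : ∀ s, pierce s 5 = (2 - s) * (s ^ 2 + s - 1) ^ 2 := fun s => by
      have := pierce_odd s 2
      simp only [oddQuotient] at this
      rw [this]
      ring
    rcases eq_or_lt_of_le hs with hs3 | hs4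
    · have hl : l = 0 := by
        by_contra hl
        obtain ⟨j, rfl⟩ := Nat.exists_eq_add_of_le' (Nat.one_le_iff_ne_zero.2 hl)
        have := eighteen_le_two_sub_pierce ht (N := 5 ^ j) (h := 1) (by positivity)
        rw [show 5 ^ (j + 1) = 5 ^ j * (2 * (1 + 1) + 1) by ring] at hs3
        omega
      subst hl
      rw [pow_zero, pierce_one] at hs3
      -- At `s = 3` the first-power comparison `25 · 5 < 121` fails. Excluding `n = 5` and `n = 10`
      -- leaves `φ(m) = 2`, and `25 · 5² < 121²` holds.
      have hm' : m = 3 ∨ m = 4 ∨ m = 6 := by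
        have hle : m ≤ 6 := by
          rcases hm with h | h <;> have := Nat.le_of_dvd (by norm_num) h <;> omega
        interval_cases m <;> simp_all
      have hφ : m.totient = 2 := by rcases hm' with rfl | rfl | rfl <;> decide
      refine lt_abs_quadNorm_cyclotomic_of_pow_lt ht hp hpm ?_
      rw [hφ, pow_zero, pierce_one, ← hs3, h5]
      norm_num
    · refine lt_abs_quadNorm_cyclotomic ht hp hpm hp1 ?_
      rw [h5]
      set s := 2 - pierce t (5 ^ l)
      have : 19 ≤ s ^ 2 + s - 1 := by nlinarith
      have := mul_self_le_mul_self (by norm_num : (0 : ℤ) ≤ 19) this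
      push_cast
      nlinarith
  · refine lt_abs_quadNorm_cyclotomic ht hp hpm hp1 ?_
    obtain ⟨j, rfl⟩ := Nat.exists_eq_add_of_le' (by omega : 3 ≤ h)
    have hD := lt_oddQuotient hs j
    set s := 2 - pierce t (p ^ l)
    have hpp : (p : ℤ) = 2 * (j + 3 : ℕ) + 1 := by exact_mod_cast hh
    rw [← hpp] at hD
    rw [show pierce s p = (2 - s) * oddQuotient s (j + 3) ^ 2 by rw [hh, pierce_odd]]
    have := mul_self_le_mul_self (by positivity) hD
    nlinarith

theorem one_lt_abs_quadNorm_cyclotomic {t : ℤ} (ht : 3 ≤ t) {n : ℕ} (hn7 : 7 ≤ n) :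
    1 < |quadNorm t (cyclotomic n ℤ)| := by
  rcases Nat.eq_two_pow_or_exists_odd_prime_and_dvd n with ⟨k, rfl⟩ | ⟨p, hp, hpn, h, hh⟩
  · have hk : 3 ≤ k := by
      by_contra! hk
      interval_cases k <;> omega
    obtain ⟨j, rfl⟩ := Nat.exists_eq_add_of_le' hk
    have := fortySeven_le_two_sub_pierce ht (N := 2 ^ j) (by positivity)
    rw [← mul_one (2 ^ (j + 3))]
    refine lt_abs_quadNorm_cyclotomic (l := j + 2) ht Nat.prime_two (by norm_num) le_rfl ?_
    rw [pierce_two, show 2 ^ (j + 2) = 2 ^ j * 4 by ring]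
    nlinarith
  · obtain ⟨k, m, hpm, rfl⟩ := Nat.exists_eq_pow_mul_and_not_dvd (n := n) (by omega) p
      hp.ne_one
    have hk : k ≠ 0 := by
      rintro rfl
      rw [pow_zero, one_mul] at hpn
      exact hpm hpn
    obtain ⟨l, rfl⟩ := Nat.exists_eq_add_of_le' (Nat.one_le_iff_ne_zero.2 hk)
    have hs := three_le_two_sub_pierce ht (pow_ne_zero l hp.ne_zero)
    refine lt_abs_quadNorm_cyclotomic ht hp hpm le_rfl ?_
    have hp2 := hp.two_le
    obtain ⟨j, rfl⟩ := Nat.exists_eq_add_of_le' (by omega : 1 ≤ h)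
    set s := 2 - pierce t (p ^ l)
    rw [show pierce s p = (2 - s) * oddQuotient s (j + 1) ^ 2 by rw [hh, pierce_odd]]
    nlinarith [mul_self_le_mul_self (by norm_num) (four_le_oddQuotient hs j)]

/-! ### Primitive prime divisors at indices from 7 on -/

theorem exists_rank_of_prime (t : ℤ) {p : ℕ} (hp : p.Prime) :
    ∃ m, ∀ j, (p : ℤ) ∣ pierce t j ↔ m ∣ j := by
  have := Fact.mk hp
  let F := AlgebraicClosure (ZMod p)
  have : CharP F p := charP_of_injective_algebraMap (algebraMap (ZMod p) F).injective p
  obtain ⟨α, β, hs, hαβ⟩ := exists_quadratic_roots t F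
  refine ⟨orderOf α, fun j => ?_⟩
  rw [← CharP.intCast_eq_zero_iff F p, pierce_cast hs hαβ, eq_inv_of_mul_eq_one_right hαβ,
    orderOf_dvd_iff_pow_eq_one, mul_eq_zero, sub_eq_zero, sub_eq_zero, inv_pow, inv_eq_one, or_self]

/-- `t² - 3` is never divisible by 4 or 9, so its part built from 2 and 3 is at most 6, while `t ≥
4` makes it at least 13. -/
theorem exists_prime_dvd_sq_sub_three {t : ℤ} (ht : 4 ≤ t) :
    ∃ p : ℕ, p.Prime ∧ (p : ℤ) ∣ t ^ 2 - 3 ∧ p ≠ 2 ∧ p ≠ 3 := by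
  obtain ⟨d, hd⟩ := Int.eq_ofNat_of_zero_le (a := t ^ 2 - 3) (by nlinarith)
  have hd13 : 13 ≤ d := by zify; rw [← hd]; nlinarith
  have h4 : ¬ 4 ∣ d := by
    zify
    rw [← hd, Int.dvd_iff_emod_eq_zero]
    have : t % 4 = 0 ∨ t % 4 = 1 ∨ t % 4 = 2 ∨ t % 4 = 3 := by omega
    rcases this with h | h | h | h <;> simp [pow_two, Int.sub_emod, Int.mul_emod, h]
  have h9 : ¬ 9 ∣ d := by
    zify
    rw [← hd, Int.dvd_iff_emod_eq_zero]
    have : t % 9 = 0 ∨ t % 9 = 1 ∨ t % 9 = 2 ∨ t % 9 = 3 ∨ t % 9 = 4 ∨ t % 9 = 5 ∨ t % 9 = 6 ∨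
      t % 9 = 7 ∨ t % 9 = 8 := by omega
    rcases this with h | h | h | h | h | h | h | h | h <;>
      simp [pow_two, Int.sub_emod, Int.mul_emod, h]
  obtain ⟨e, he⟩ := Nat.gcd_dvd_left d 6
  have hg : d.gcd 6 ≤ 6 := Nat.gcd_le_right d (by norm_num)
  obtain ⟨p, hp, hpe⟩ := Nat.exists_prime_and_dvd (n := e) (by rintro rfl; omega)
  have hpd : p ∣ d := he ▸ hpe.mul_left _
  refine ⟨p, hp, by rw [hd]; exact_mod_cast hpd, ?_, ?_⟩
  · rintro rfl
    exact h4 (he ▸ mul_dvd_mul (Nat.dvd_gcd hpd (by norm_num)) hpe : 2 * 2 ∣ d)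
  · rintro rfl
    exact h9 (he ▸ mul_dvd_mul (Nat.dvd_gcd hpd (by norm_num)) hpe : 3 * 3 ∣ d)

theorem hasPrimitivePrimeDivisor_pierce_twelve {t : ℤ} (ht : 4 ≤ t) :
    HasPrimitivePrimeDivisor (pierce t) 12 := by
  have h6 : pierce t 6 = (4 - t ^ 2) * (t ^ 2 - 3 + 2) ^ 2 := by
    rw [show pierce t 6 = pierce (2 - pierce t 3) 2 from pierce_mul t 3 2, pierce_two, pierce_three]
    ring
  have h4 : pierce t 4 = t ^ 2 * (4 - t ^ 2) := by
    rw [show pierce t 4 = pierce (2 - pierce t 2) 2 from pierce_mul t 2 2, pierce_two, pierce_two]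
    ring
  have h12 : pierce t 12 = (t ^ 2 - 3) * (pierce t 6 * t ^ 2 * (t ^ 2 - 3)) := by
    rw [show pierce t 12 = pierce (2 - pierce t 6) 2 from pierce_mul t 6 2, pierce_two, h6]
    ring
  obtain ⟨p, hp, hpd, hp2, hp3⟩ := exists_prime_dvd_sq_sub_three ht
  obtain ⟨m, hm⟩ := exists_rank_of_prime t hp
  have hp' := Nat.prime_iff_prime_int.1 hp
  have hle : ∀ k : ℕ, k.Prime → p ≠ k → ¬ (p : ℤ) ∣ k := fun k hk hne h =>
    hne ((Nat.prime_dvd_prime_iff_eq hp hk).1 (by exact_mod_cast h))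
  have ha : ¬ (p : ℤ) ∣ 4 - t ^ 2 := fun h => hp'.not_dvd_one (by
    have := dvd_add h hpd
    rwa [show (4 - t ^ 2) + (t ^ 2 - 3) = 1 by ring] at this)
  have hb : ¬ (p : ℤ) ∣ t ^ 2 := fun h => hle 3 Nat.prime_three hp3 (by
    have := dvd_sub h hpd
    rwa [show t ^ 2 - (t ^ 2 - 3) = (3 : ℕ) by push_cast; ring] at this)
  have hc : ¬ (p : ℤ) ∣ (t ^ 2 - 3 + 2) ^ 2 := fun h =>
    hle 2 Nat.prime_two hp2 ((dvd_add_right hpd).1 (hp'.dvd_of_dvd_pow h))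
  have hm12 : m ∣ 12 := (hm 12).1 (h12 ▸ hpd.mul_right _)
  have hm4 : ¬ m ∣ 4 := fun h => (hp'.dvd_or_dvd (h4 ▸ (hm 4).2 h)).elim hb ha
  have hm6 : ¬ m ∣ 6 := fun h => (hp'.dvd_or_dvd (h6 ▸ (hm 6).2 h)).elim ha hc
  have hle12 := Nat.le_of_dvd (by norm_num) hm12
  have hm_eq : m = 12 := by interval_cases m <;> omega
  subst hm_eq
  exact ⟨p, hp, (hm 12).2 dvd_rfl, fun j h1 h2 _ h3 =>
    absurd (Nat.le_of_dvd h1 ((hm j).1 h3)) (by omega)⟩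

theorem hasPrimitivePrimeDivisor_pierce {t : ℤ} (ht : 3 ≤ t) {n : ℕ} (hn7 : 7 ≤ n)
    (hn12 : n = 12 → t ≠ 3) (hn10 : n = 10 → t ≠ 3) :
    HasPrimitivePrimeDivisor (pierce t) n := by
  by_cases h12 : n = 12
  · subst h12
    exact hasPrimitivePrimeDivisor_pierce_twelve (lt_of_le_of_ne ht (hn12 rfl).symm)
  by_contra hno
  set c := (quadNorm t (cyclotomic n ℤ)).natAbs with hc
  have hc1 : 1 < c := by
    have := one_lt_abs_quadNorm_cyclotomic ht hn7
    rw [Int.abs_eq_natAbs] at this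
    exact_mod_cast this
  have hrank : ∀ q : ℕ, q.Prime → q ∣ c → ∃ k m, n = q ^ k * m ∧ k ≠ 0 ∧ ¬ q ∣ m ∧
      (∀ j, (q : ℤ) ∣ pierce t j ↔ m ∣ j) ∧ (m ∣ q - 1 ∨ m ∣ q + 1) := by
    intro q hq hqc
    obtain ⟨k, m, hn, hqm, hj, hm⟩ := exists_rank_of_prime_dvd_cyclotomic (t := t) (n := n)
      (by omega) hq (Int.natCast_dvd.2 hqc)
    refine ⟨k, m, hn, ?_, hqm, hj, hm⟩
    rintro rfl
    rw [pow_zero, one_mul] at hn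
    subst hn
    exact hno ⟨q, hq, (hj n).2 dvd_rfl, fun j h1 h2 _ h3 =>
      absurd (Nat.le_of_dvd h1 ((hj j).1 h3)) (by omega)⟩
  -- If `p < q` both occur, `q` divides the rank of `p`, which is at most `p + 1`; this forces `p =
  -- 2`, `q = 3`. Then `8 ∣ n` makes 8 divide the rank of 3, itself a divisor of 2 or 4.
  have hlt : ∀ p q : ℕ, p.Prime → q.Prime → p ∣ c → q ∣ c → ¬ p < q := by
    intro p q hp hq hpc hqc hpq
    obtain ⟨k, m, hn, hk, hpm, -, hm⟩ := hrank p hp hpc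
    obtain ⟨k', m', hn', hk', -, -, hm'⟩ := hrank q hq hqc
    have hqm : q ∣ m := by
      have : q ∣ p ^ k * m := hn ▸ hn' ▸ (dvd_pow_self q hk').mul_right m'
      exact ((Nat.coprime_primes hq hp).2 hpq.ne').pow_right k |>.dvd_of_dvd_mul_left this
    have hp2 := hp.two_le
    have hqle : q ≤ p + 1 := by
      rcases hm with h | h
      · have := Nat.le_of_dvd (by omega) (hqm.trans h)
        omega
      · exact Nat.le_of_dvd (by omega) (hqm.trans h)
    have hq1 : q = p + 1 := by omega
    have hp2' : p = 2 := by
      rcases hp.eq_two_or_odd' with h | h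
      · exact h
      · have := hq.eq_two_or_odd'.resolve_left (by omega)
        rw [hq1] at this
        exact absurd h.add_one (Nat.not_even_iff_odd.2 this)
    subst hp2'
    subst hq1
    have hk3 := eight_dvd_of_rank_two hn hm hn7 h12
    have h8 : 8 ∣ m' := by
      have : 2 ^ 3 ∣ 3 ^ k' * m' := hn' ▸ hn ▸ (pow_dvd_pow 2 hk3).mul_right m
      exact (Nat.Coprime.pow 3 k' (by norm_num)).dvd_of_dvd_mul_left this
    rcases hm' with h | h
    · exact absurd (Nat.le_of_dvd (by norm_num) (h8.trans h)) (by norm_num)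
    · exact absurd (Nat.le_of_dvd (by norm_num) (h8.trans h)) (by norm_num)
  obtain ⟨p, hp, hpc⟩ := Nat.exists_prime_and_dvd hc1.ne'
  obtain ⟨k, m, hn, hk, hpm, hj, hm⟩ := hrank p hp hpc
  have hpow := Nat.eq_prime_pow_of_unique_prime_dvd (p := p) (n := c) (by omega)
    fun {q} hq hqc => le_antisymm (not_lt.1 (hlt p q hp hq hpc hqc))
      (not_lt.1 (hlt q p hq hp hqc hpc))
  have hcube := not_cube_dvd_quadNorm_cyclotomic ht hp hn hk hj hm hn7 h12
  have hsize := sq_lt_abs_quadNorm_cyclotomic ht hp hn hk hpm hm hn7 h12 hn10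
  rw [Int.abs_eq_natAbs, ← hc] at hsize
  have hsize' : p ^ 2 < c := by exact_mod_cast hsize
  rw [hpow] at hsize'
  have he := (Nat.pow_lt_pow_iff_right hp.one_lt).1 hsize'
  refine hcube ?_
  have : p ^ 3 ∣ c := hpow ▸ pow_dvd_pow p he
  have := Int.natCast_dvd.2 this
  exact_mod_cast this

end QuadNorm

/-! ### From units to traces -/

theorem norm_sub_one_of_norm_eq_one {K : Type*} [Field K] [Algebra ℚ K]
    (hK : Module.finrank ℚ K = 2) {β : K} (hβ : Algebra.norm ℚ β = 1) :
    algebraMap ℚ K (Algebra.norm ℚ (β - 1)) = (β - 1) * (β⁻¹ - 1) := by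
  have : Module.Finite ℚ K := Module.finite_of_finrank_eq_succ hK
  have hβ0 : β ≠ 0 := by
    rintro rfl
    rw [Algebra.norm_zero] at hβ
    exact zero_ne_one hβ
  let b := Module.finBasisOfFinrankEq ℚ K hK
  set M := Algebra.leftMulMatrix b β with hM
  have hdet : M 0 0 * M 1 1 - M 0 1 * M 1 0 = 1 := by
    rw [← Matrix.det_fin_two, hM, ← Algebra.norm_eq_matrix_det, hβ]
  have hnorm : Algebra.norm ℚ (β - 1) = 2 - (M 0 0 + M 1 1) := by
    rw [Algebra.norm_eq_matrix_det b, map_sub, map_one, ← hM, Matrix.det_fin_two]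
    simp
    linear_combination hdet
  -- Cayley–Hamilton for multiplication by `β`, whose determinant is 1.
  have hpoly : β * β - (M 0 0 + M 1 1) • β + 1 = 0 := by
    apply Algebra.leftMulMatrix_injective b
    rw [map_add, map_sub, map_mul, map_smul, map_one, map_zero, ← hM]
    ext i j
    fin_cases i <;> fin_cases j <;> simp [Matrix.mul_apply, Fin.sum_univ_two] <;>
      first | ring1 | linear_combination -hdet
  rw [hnorm, map_sub, map_ofNat]
  rw [Algebra.smul_def] at hpoly
  field_simp
  linear_combination hpoly

theorem finrank_realQuadraticField (d : ℕ) :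
    Module.finrank ℚ (RealQuadraticField d) = 1 ∨ Module.finrank ℚ (RealQuadraticField d) = 2 := by
  have hroot : Polynomial.aeval (√(d : ℝ)) (Polynomial.X ^ 2 - Polynomial.C (d : ℚ)) = 0 := by simp
  have hmonic := Polynomial.monic_X_pow_sub_C (d : ℚ) two_ne_zero
  have hle : (minpoly ℚ (√(d : ℝ))).natDegree ≤ 2 := by
    have := Polynomial.natDegree_le_natDegree (minpoly.min ℚ (√(d : ℝ)) hmonic hroot)
    rwa [Polynomial.natDegree_X_pow_sub_C] at this
  have hpos : 0 < Module.finrank ℚ (RealQuadraticField d) := Module.finrank_pos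
  rw [IntermediateField.adjoin.finrank ⟨_, hmonic, hroot⟩] at hpos ⊢
  omega

theorem exists_lehmerPierce_eq_pierce {d : ℕ} {u : (𝓞 (RealQuadraticField d))ˣ} (hu_ne : u ≠ 1)
    (hu_norm : Algebra.norm ℚ ((u : 𝓞 (RealQuadraticField d)) : RealQuadraticField d) = 1) :
    ∃ t : ℤ, unitToReal u + (unitToReal u)⁻¹ = t ∧ unitToReal u ≠ 1 ∧ unitToReal u ≠ 0 ∧
      lehmerPierce (RealQuadraticField d) u = pierce t := by
  set v : RealQuadraticField d := ((u : 𝓞 (RealQuadraticField d)) : RealQuadraticField d) with hv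
  have hv1 : v ≠ 1 := fun h => hu_ne (Units.ext (NumberField.RingOfIntegers.ext h))
  have hv0 : v ≠ 0 := by
    intro h
    rw [h, Algebra.norm_zero] at hu_norm
    exact zero_ne_one hu_norm
  -- In degree 1 (as for `d = 1`) the norm is the identity, and norm 1 would force `u = 1`.
  have hfr : Module.finrank ℚ (RealQuadraticField d) = 2 := by
    refine (finrank_realQuadraticField d).resolve_left fun h1 => hv1 ?_
    have hmem : v ∈ (⊥ : Subalgebra ℚ (RealQuadraticField d)) := by
      rw [Subalgebra.bot_eq_top_of_finrank_eq_one h1]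
      exact Algebra.mem_top
    obtain ⟨q, hq⟩ := Algebra.mem_bot.1 hmem
    rw [← hq, Algebra.norm_algebraMap, h1, pow_one] at hu_norm
    rw [← hq, hu_norm, map_one]
  have hx : unitToReal u = (v : ℝ) := rfl
  have hx0 : unitToReal u ≠ 0 := by
    rw [hx]
    exact_mod_cast hv0
  have hcast : ∀ n, (lehmerPierce (RealQuadraticField d) u n : ℝ) =
      (unitToReal u ^ n - 1) * ((unitToReal u)⁻¹ ^ n - 1) := by
    intro n
    have h1 := norm_sub_one_of_norm_eq_one hfr (β := v ^ n) (by rw [map_pow, hu_norm, one_pow])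
    rw [← coe_lehmerPierce] at h1
    have h2 := congrArg (fun z : RealQuadraticField d => (z : ℝ)) h1
    simpa [hx] using h2
  have hs : unitToReal u + (unitToReal u)⁻¹ =
      ((2 - lehmerPierce (RealQuadraticField d) u 1 : ℤ) : ℝ) := by
    push_cast
    rw [hcast]
    field_simp
    ring
  refine ⟨_, hs, ?_, hx0, ?_⟩
  · rw [hx]
    exact_mod_cast hv1
  · funext n
    have := hcast n
    rw [← pierce_cast hs (mul_inv_cancel₀ hx0)] at this
    exact_mod_cast this

/-! ### The exceptional traces 3, 4, 5, 6 -/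

theorem mem_nonPrimitiveIndices_of_dvd_pow {a : ℕ → ℤ} {n i j k : ℕ} (hi : 1 ≤ i) (hin : i < n)
    (hj : 1 ≤ j) (hjn : j < n) (hai : a i ≠ 0) (haj : a j ≠ 0) (h : a n ∣ (a i * a j) ^ k) :
    n ∈ nonPrimitiveIndices a := by
  refine ⟨by omega, ?_⟩
  rintro ⟨p, hp, hpn, hprim⟩
  have hp' := Nat.prime_iff_prime_int.1 hp
  rcases hp'.dvd_or_dvd (hp'.dvd_of_dvd_pow (hpn.trans h)) with h1 | h1
  · exact hprim i hi hin hai h1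
  · exact hprim j hj hjn haj h1

theorem not_mem_nonPrimitiveIndices {a : ℕ → ℤ} {n : ℕ} (p : ℕ) (hp : p.Prime)
    (hpn : (p : ℤ) ∣ a n) (h : ∀ m, 1 ≤ m → m < n → ¬ (p : ℤ) ∣ a m) :
    n ∉ nonPrimitiveIndices a :=
  fun hn => hn.2 ⟨p, hp, hpn, fun m h1 h2 _ => h m h1 h2⟩

theorem le_six_of_mem_nonPrimitiveIndices {t : ℤ} (ht : 3 ≤ t) {n : ℕ}
    (hn12 : n = 12 → t ≠ 3) (hn10 : n = 10 → t ≠ 3) (hn : n ∈ nonPrimitiveIndices (pierce t)) :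
    n ≤ 6 := by
  by_contra! h
  exact hn.2 (hasPrimitivePrimeDivisor_pierce ht h hn12 hn10)

theorem nonPrimitiveIndices_pierce_three : nonPrimitiveIndices (pierce 3) = {1, 6, 10, 12} := by
  have e1 : pierce 3 1 = -1 := pierce_one 3
  have e2 : pierce 3 2 = -5 := pierce_two 3
  have e3 : pierce 3 3 = -16 := pierce_three 3
  have e4 : pierce 3 4 = -45 := by rw [pierce_add_two, e3, e2]; norm_num
  have e5 : pierce 3 5 = -121 := by rw [pierce_add_two, e4, e3]; norm_num
  have e6 : pierce 3 6 = -320 := by rw [pierce_add_two, e5, e4]; norm_num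
  have e10 : pierce 3 10 = -15125 := by
    rw [show pierce 3 10 = pierce (2 - pierce 3 5) 2 from pierce_mul 3 5 2, e5, pierce_two]
    norm_num
  have e12 : pierce 3 12 = -103680 := by
    rw [show pierce 3 12 = pierce (2 - pierce 3 6) 2 from pierce_mul 3 6 2, e6, pierce_two]
    norm_num
  ext n
  simp only [Set.mem_insert_iff, Set.mem_singleton_iff]
  constructor
  · intro hn
    by_contra! hne
    have hn6 := le_six_of_mem_nonPrimitiveIndices le_rfl (fun h => absurd h hne.2.2.2)
      (fun h => absurd h hne.2.2.1) hn
    have hn1 := hn.1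
    revert hn
    interval_cases n
    · omega
    · refine not_mem_nonPrimitiveIndices 5 (by norm_num) (by rw [e2]; norm_num) fun m _ _ => ?_
      interval_cases m; rw [e1]; norm_num
    · refine not_mem_nonPrimitiveIndices 2 (by norm_num) (by rw [e3]; norm_num) fun m _ _ => ?_
      interval_cases m <;> simp only [e1, e2] <;> norm_num
    · refine not_mem_nonPrimitiveIndices 3 (by norm_num) (by rw [e4]; norm_num) fun m _ _ => ?_
      interval_cases m <;> simp only [e1, e2, e3] <;> norm_num
    · refine not_mem_nonPrimitiveIndices 11 (by norm_num) (by rw [e5]; norm_num) fun m _ _ => ?_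
      interval_cases m <;> simp only [e1, e2, e3, e4] <;> norm_num
    · omega
  · rintro (rfl | rfl | rfl | rfl)
    · refine ⟨le_rfl, ?_⟩
      rintro ⟨p, hp, hpd, -⟩
      rw [e1] at hpd
      exact (Nat.prime_iff_prime_int.1 hp).not_dvd_one ((dvd_neg).1 hpd)
    · apply mem_nonPrimitiveIndices_of_dvd_pow (i := 2) (j := 3) (k := 6) <;> norm_num [e2, e3, e6]
    · apply mem_nonPrimitiveIndices_of_dvd_pow (i := 2) (j := 5) (k := 3) <;> norm_num [e2, e5, e10]
    · apply mem_nonPrimitiveIndices_of_dvd_pow (i := 3) (j := 4) (k := 4) <;> norm_num [e3, e4, e12]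

theorem nonPrimitiveIndices_pierce_four : nonPrimitiveIndices (pierce 4) = {4, 6} := by
  have e1 : pierce 4 1 = -2 := pierce_one 4
  have e2 : pierce 4 2 = -12 := pierce_two 4
  have e3 : pierce 4 3 = -50 := pierce_three 4
  have e4 : pierce 4 4 = -192 := by rw [pierce_add_two, e3, e2]; norm_num
  have e5 : pierce 4 5 = -722 := by rw [pierce_add_two, e4, e3]; norm_num
  have e6 : pierce 4 6 = -2700 := by rw [pierce_add_two, e5, e4]; norm_num
  ext n
  simp only [Set.mem_insert_iff, Set.mem_singleton_iff]
  constructor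
  · intro hn
    have hn6 := le_six_of_mem_nonPrimitiveIndices (by norm_num) (by norm_num) (by norm_num) hn
    have hn1 := hn.1
    by_contra! hne
    revert hn
    interval_cases n
    · exact not_mem_nonPrimitiveIndices 2 (by norm_num) (by rw [e1]; norm_num) (by omega)
    · refine not_mem_nonPrimitiveIndices 3 (by norm_num) (by rw [e2]; norm_num) fun m _ _ => ?_
      interval_cases m; rw [e1]; norm_num
    · refine not_mem_nonPrimitiveIndices 5 (by norm_num) (by rw [e3]; norm_num) fun m _ _ => ?_
      interval_cases m <;> simp only [e1, e2] <;> norm_num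
    · omega
    · refine not_mem_nonPrimitiveIndices 19 (by norm_num) (by rw [e5]; norm_num) fun m _ _ => ?_
      interval_cases m <;> simp only [e1, e2, e3, e4] <;> norm_num
    · omega
  · rintro (rfl | rfl)
    · apply mem_nonPrimitiveIndices_of_dvd_pow (i := 1) (j := 2) (k := 6) <;> norm_num [e1, e2, e4]
    · apply mem_nonPrimitiveIndices_of_dvd_pow (i := 2) (j := 3) (k := 3) <;> norm_num [e2, e3, e6]

theorem nonPrimitiveIndices_pierce_five : nonPrimitiveIndices (pierce 5) = {6} := by
  have e1 : pierce 5 1 = -3 := pierce_one 5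
  have e2 : pierce 5 2 = -21 := pierce_two 5
  have e3 : pierce 5 3 = -108 := pierce_three 5
  have e4 : pierce 5 4 = -525 := by rw [pierce_add_two, e3, e2]; norm_num
  have e5 : pierce 5 5 = -2523 := by rw [pierce_add_two, e4, e3]; norm_num
  have e6 : pierce 5 6 = -12096 := by rw [pierce_add_two, e5, e4]; norm_num
  ext n
  rw [Set.mem_singleton_iff]
  constructor
  · intro hn
    have hn6 := le_six_of_mem_nonPrimitiveIndices (by norm_num) (by norm_num) (by norm_num) hn
    have hn1 := hn.1
    by_contra! hne
    revert hn
    interval_cases n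
    · exact not_mem_nonPrimitiveIndices 3 (by norm_num) (by rw [e1]; norm_num) (by omega)
    · refine not_mem_nonPrimitiveIndices 7 (by norm_num) (by rw [e2]; norm_num) fun m _ _ => ?_
      interval_cases m; rw [e1]; norm_num
    · refine not_mem_nonPrimitiveIndices 2 (by norm_num) (by rw [e3]; norm_num) fun m _ _ => ?_
      interval_cases m <;> simp only [e1, e2] <;> norm_num
    · refine not_mem_nonPrimitiveIndices 5 (by norm_num) (by rw [e4]; norm_num) fun m _ _ => ?_
      interval_cases m <;> simp only [e1, e2, e3] <;> norm_num
    · refine not_mem_nonPrimitiveIndices 29 (by norm_num) (by rw [e5]; norm_num) fun m _ _ => ?_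
      interval_cases m <;> simp only [e1, e2, e3, e4] <;> norm_num
    · omega
  · rintro rfl
    apply mem_nonPrimitiveIndices_of_dvd_pow (i := 2) (j := 3) (k := 3) <;> norm_num [e2, e3, e6]

theorem nonPrimitiveIndices_pierce_six : nonPrimitiveIndices (pierce 6) = {2} := by
  have e1 : pierce 6 1 = -4 := pierce_one 6
  have e2 : pierce 6 2 = -32 := pierce_two 6
  have e3 : pierce 6 3 = -196 := pierce_three 6
  have e4 : pierce 6 4 = -1152 := by rw [pierce_add_two, e3, e2]; norm_num
  have e5 : pierce 6 5 = -6724 := by rw [pierce_add_two, e4, e3]; norm_num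
  have e6 : pierce 6 6 = -39200 := by rw [pierce_add_two, e5, e4]; norm_num
  ext n
  rw [Set.mem_singleton_iff]
  constructor
  · intro hn
    have hn6 := le_six_of_mem_nonPrimitiveIndices (by norm_num) (by norm_num) (by norm_num) hn
    have hn1 := hn.1
    by_contra! hne
    revert hn
    interval_cases n
    · exact not_mem_nonPrimitiveIndices 2 (by norm_num) (by rw [e1]; norm_num) (by omega)
    · omega
    · refine not_mem_nonPrimitiveIndices 7 (by norm_num) (by rw [e3]; norm_num) fun m _ _ => ?_
      interval_cases m <;> simp only [e1, e2] <;> norm_num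
    · refine not_mem_nonPrimitiveIndices 3 (by norm_num) (by rw [e4]; norm_num) fun m _ _ => ?_
      interval_cases m <;> simp only [e1, e2, e3] <;> norm_num
    · refine not_mem_nonPrimitiveIndices 41 (by norm_num) (by rw [e5]; norm_num) fun m _ _ => ?_
      interval_cases m <;> simp only [e1, e2, e3, e4] <;> norm_num
    · refine not_mem_nonPrimitiveIndices 5 (by norm_num) (by rw [e6]; norm_num) fun m _ _ => ?_
      interval_cases m <;> simp only [e1, e2, e3, e4, e5] <;> norm_num
  · rintro rfl
    apply mem_nonPrimitiveIndices_of_dvd_pow (i := 1) (j := 1) (k := 3) <;> norm_num [e1, e2]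

/-! ### Recovering the unit from its trace -/

theorem eq_or_eq_of_add_inv_eq {x t r s : ℝ} (hx : x ≠ 0) (h : x + x⁻¹ = t) (hrs : r + s = t)
    (hp : r * s = 1) : x = r ∨ x = s := by
  have hi := mul_inv_cancel₀ hx
  have : (x - r) * (x - s) = 0 := by linear_combination x * h - hi - x * hrs + hp
  exact (mul_eq_zero.1 this).imp sub_eq_zero.1 sub_eq_zero.1

theorem theorem3p1 (d : ℕ) (hd : Squarefree d)
    (u : (𝓞 (RealQuadraticField d))ˣ)
    (hu_ne : u ≠ 1)
    (hu_pos : 0 < unitToReal u)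
    (hu_norm : Algebra.norm ℚ ((u : 𝓞 (RealQuadraticField d)) : RealQuadraticField d) = 1) :
    ((unitToReal u < 1 / 6 ∨ 6 < unitToReal u) →
      zsigmondyBound (lehmerPierce (RealQuadraticField d) u) ≤ 6) ∧
    (¬ (unitToReal u < 1 / 6 ∨ 6 < unitToReal u) →
      ((unitToReal u = 3 + 2 * Real.sqrt 2 ∨ unitToReal u = 3 - 2 * Real.sqrt 2) ∧
        zsigmondyBound (lehmerPierce (RealQuadraticField d) u) = 2) ∨
      ((unitToReal u = 2 + Real.sqrt 3 ∨ unitToReal u = 2 - Real.sqrt 3) ∧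
        zsigmondyBound (lehmerPierce (RealQuadraticField d) u) = 6 ∧
        nonPrimitiveIndices (lehmerPierce (RealQuadraticField d) u) = {4, 6}) ∨
      ((unitToReal u = (3 + Real.sqrt 5) / 2 ∨ unitToReal u = (3 - Real.sqrt 5) / 2) ∧
        zsigmondyBound (lehmerPierce (RealQuadraticField d) u) = 12 ∧
        nonPrimitiveIndices (lehmerPierce (RealQuadraticField d) u) = {1, 6, 10, 12}) ∨
      ((unitToReal u = (5 + Real.sqrt 21) / 2 ∨ unitToReal u = (5 - Real.sqrt 21) / 2) ∧
        zsigmondyBound (lehmerPierce (RealQuadraticField d) u) = 6 ∧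
        nonPrimitiveIndices (lehmerPierce (RealQuadraticField d) u) = {6})) := by
  obtain ⟨t, hs, hx1, hx0, hfun⟩ := exists_lehmerPierce_eq_pierce hu_ne hu_norm
  rw [hfun]
  set x := unitToReal u
  have hi := mul_inv_cancel₀ hx0
  have hipos : 0 < x⁻¹ := inv_pos.2 hu_pos
  have ht : 3 ≤ t := by
    have : ((2 : ℤ) : ℝ) < t := by
      push_cast
      rw [← hs]
      have : 0 < (x - 1) ^ 2 * x⁻¹ :=
        mul_pos (sq_pos_of_ne_zero (sub_ne_zero.2 hx1)) hipos
      linear_combination this + (x - 2) * hi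
    have : 2 < t := by exact_mod_cast this
    omega
  constructor
  · intro hx
    have ht7 : 6 < t := by
      have : ((6 : ℤ) : ℝ) < t := by
        push_cast
        rw [← hs]
        rcases hx with h | h
        · nlinarith
        · linarith
      exact_mod_cast this
    exact iSup₂_le fun n hn => by
      exact_mod_cast le_six_of_mem_nonPrimitiveIndices ht (fun _ => by omega) (fun _ => by omega) hn
  · intro hx
    push Not at hx
    have ht6 : t < 7 := by
      have : (t : ℝ) < (7 : ℤ) := by
        push_cast
        rw [← hs]
        -- On `[1/6, 6]` the sum `x + x⁻¹` is at most its endpoint value `37/6`, below 7.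
        have := mul_nonneg (mul_nonneg (sub_nonneg.2 hx.1) (sub_nonneg.2 hx.2)) hipos.le
        have e : (x - 1 / 6) * (6 - x) * x⁻¹ = 37 / 6 - x - x⁻¹ := by
          linear_combination (37 / 6 - x) * hi
        linarith
      exact_mod_cast this
    have h2 := Real.mul_self_sqrt (zero_le_two (α := ℝ))
    have h3 := Real.mul_self_sqrt (zero_le_three (α := ℝ))
    have h5 := Real.mul_self_sqrt (Nat.ofNat_nonneg (α := ℝ) 5)
    have h21 := Real.mul_self_sqrt (Nat.ofNat_nonneg (α := ℝ) 21)
    interval_cases t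
    · refine .inr (.inr (.inl ⟨eq_or_eq_of_add_inv_eq hx0 hs (by push_cast; ring)
        (by linear_combination -h5 / 4), ?_, nonPrimitiveIndices_pierce_three⟩))
      refine zsigmondyBound_eq_of_isGreatest (N := 12) ?_
      rw [nonPrimitiveIndices_pierce_three]
      exact ⟨by simp, fun n hn => by simp at hn; omega⟩
    · refine .inr (.inl ⟨eq_or_eq_of_add_inv_eq hx0 hs (by push_cast; ring)
        (by linear_combination -h3), ?_, nonPrimitiveIndices_pierce_four⟩)
      refine zsigmondyBound_eq_of_isGreatest (N := 6) ?_
      rw [nonPrimitiveIndices_pierce_four]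
      exact ⟨by simp, fun n hn => by simp at hn; omega⟩
    · refine .inr (.inr (.inr ⟨eq_or_eq_of_add_inv_eq hx0 hs (by push_cast; ring)
        (by linear_combination -h21 / 4), ?_, nonPrimitiveIndices_pierce_five⟩))
      refine zsigmondyBound_eq_of_isGreatest (N := 6) ?_
      rw [nonPrimitiveIndices_pierce_five]
      exact isGreatest_singleton
    · refine .inl ⟨eq_or_eq_of_add_inv_eq hx0 hs (by push_cast; ring)
        (by linear_combination -4 * h2), ?_⟩
      refine zsigmondyBound_eq_of_isGreatest (N := 2) ?_
      rw [nonPrimitiveIndices_pierce_six]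
      exact isGreatest_singleton
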